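/- **Theorem (SocChain satisfies the safety property).** In every execution of SocChain, at every moment, the two chains of blocks maintained locally by two correct nodes are either identical or one is a prefix of the other. **System.** Nodes communicate by authenticated point-to-point messages (the sender cannot be forged) over an asynchronous network: messages may be delayed arbitrarily and reordered, and timers may expire at any time. Byzantine nodes may send any messages to any nodes at any time; all other nodes are *correct* and follow the protocol below. All nodes share the same genesis block $B_0$ and genesis state, the same deterministic code (transaction validation, virtual machine, hash functions, all arbitrary functions) and the constants $GL$ (gas limit) and $\mathit{nonce}$. The state determines the current *committee* (as recorded by the governance contract). If $n$ is the size of a committee and $t=t(n)$ its fault threshold, the fault assumption is that, throughout the execution, each current committee of a correct node has at most $t$ byzantine members and $t<n/3$. (A constant committee consisting of all nodes is a special case.) **Protocol.** A correct node holds a state $S$, a chain (initially $B_0$), a mempool, and runs consensus instances $i=0,1,2,\dots$, the committee of instance $i$ being read from its state when the instance starts. It adds a client transaction to the mempool if it is valid in its state. *Consensus, instance $i$.* Only members of the committee of instance $i$ take part, and only messages of members are counted. Each member may propose once: its proposal consists of the transactions of its mempool, which is then emptied, and a timestamp. 1. *Reliable broadcast.* A proposer broadcasts INIT$(m)$. On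 the first INIT$(m)$ from member $k$, a member broadcasts ECHO$(k,m)$. On ECHO$(k,m)$ from more than $(n+t)/2$ members or READY$(k,m)$ from $t+1$ members it broadcasts READY$(k,m)$, once per $k$. On READY$(k,m)$ from $2t+1$ members it delivers $\mathit{props}[k]=m$, if nothing was delivered from $k$ before. 2. *Inputs.* There is one binary consensus for each member $k$, to which a member gives at most one input: $1$ if $\mathit{props}[k]$ has been delivered; $0$ if it has not been delivered and at least $n-t$ binary consensuses have decided $1$ locally. The decision is $\mathit{bitmask}[k]$. 3. *Binary consensus* (DBFT). The estimate $\mathit{est}$ is initially the input. In round $r=1,2,\dots$ a member broadcasts BVAL$_r(\mathit{est})$. At any time, on BVAL$_r(v)$ from $t+1$ members, it may broadcast BVAL$_r(v)$ too; $v$ belongs to $\mathit{bin}_r$ once BVAL$_r(v)$ was received from $2t+1$ members. The rotating coordinator of round $r$ may broadcast COORD$_r(w)$ for one $w\in\mathit{bin}_r$. When $\mathit{bin}_r\neq\emptyset$ and a timer has expired, the member broadcasts once AUX$_r(\{w\})$ if COORD$_r(w)$ with $w\in \mathit{bin}_r$ was received from the coordinator, and AUX$_r(\mathit{bin}_r)$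 if there is no such $w$. When AUX$_r$ messages, one from each of at least $n-t$ members, have a non-empty union $V\subseteq\mathit{bin}_r$ of contents, the round ends: if $V=\{v\}$ then $\mathit{est}\leftarrow v$, and $v$ is decided if $v=r\bmod 2$ and nothing was decided before; otherwise $\mathit{est}\leftarrow r\bmod 2$. 4. *Superblock.* When all entries of $\mathit{bitmask}$ are decided and $\mathit{props}[k]$ is delivered for every $k$ with $\mathit{bitmask}[k]=1$, the superblock of the instance is the list of these $\mathit{props}[k]$ in the order of the members $k$. The member broadcasts it. A node outside the committee accepts a superblock received from $t+1$ members. *Execution.* The proposals of the superblock are executed in order. For a proposal, each transaction in turn is discarded if it is invalid in the current state and otherwise run, giving a new state and a receipt; then the block $$B_\ell=\langle h(\mathrm{header}(B_{\ell-1})),\,h(S_{\mathrm{next}}),\,h(TX),\,h(R),\,GU,\,GL,\,\mathit{nonce},\,\mathit{timestamp},\,\mathit{val}\rangle$$ is appended to the local chain, where $B_{\ell-1}$ is the last block of the chain, $S_{\mathrm{next}}$ the resulting state, $\mathit{val}$ the executed transactions, $TX$ and $R$ the tries of the executed transactions and of the receipts, $GU$ the total gas used, and $\mathit{timestamp}$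 that of the proposal. After the last proposal the node moves on to instance $i+1$, with the committee recorded in its new state. -/

import Mathlib

namespace SocChain

/-! ### Data: proposals, blocks, messages -/

/-- A proposal: a batch of transactions (in the order in which it is broadcast) and a timestamp. -/
structure Proposal (Tx : Type*) where
  txs : List Tx
  timestamp : ℕ

/-- A superblock: the accepted proposals, in the order in which they are executed. -/
abbrev Superblock (Tx : Type*) := List (Proposal Tx)

structure Header (Hash : Type*) where
  parentHash : Hash
  stateHash : Hash
  txHash : Hash
  receiptHash : Hash
  gasUsed : ℕ
  gasLimit : ℕ
  nonce : ℕ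
  timestamp : ℕ

structure Block (Tx Hash : Type*) where
  header : Header Hash
  txs : List Tx

/-- The messages of the protocol. The first argument is always the index of the consensus instance.
* `init`, `echo`, `ready`: reliable broadcast (`echo i k m` concerns the broadcast of member `k`);
* `bval`, `coord`, `aux`: binary consensus number `k` of the instance, at round `r`;
* `superblock`: a committee member hands the decided superblock to the nodes that are not
  running the consensus service. -/
inductive Msg (Node Tx : Type*) where
  | init (i : ℕ) (m : Proposal Tx)
  | echo (i : ℕ) (k : Node) (m : Proposal Tx)
  | ready (i : ℕ) (k : Node) (m : Proposal Tx)
  | bval (i : ℕ) (k : Node) (r : ℕ) (v : Bool)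
  | coord (i : ℕ) (k : Node) (r : ℕ) (w : Bool)
  | aux (i : ℕ) (k : Node) (r : ℕ) (s : Finset Bool)
  | superblock (i : ℕ) (sb : Superblock Tx)

/-- The deterministic code and constants that all nodes of one SocChain instance share.
Nothing is assumed about them. -/
structure Params (Node Tx State Receipt Hash : Type*) where
  /-- validation of a transaction (nonce, signature) against the current state -/
  isValid : State → Tx → Bool
  /-- the virtual machine: execution of a transaction -/
  run : Tx → State → State × Receipt
  /-- gas used by a transaction, as recorded in its receipt -/
  gas : Receipt → ℕ
  /-- hash of the state trie -/
  stateHash : State → Hash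
  /-- hash of the transaction trie built from the executed transactions -/
  txHash : List Tx → Hash
  /-- hash of the receipt trie built from the receipts -/
  receiptHash : List Receipt → Hash
  headerHash : Header Hash → Hash
  gasLimit : ℕ
  nonce : ℕ
  /-- the consensus committee in force, as recorded in the state by the governance contract -/
  committee : State → Finset Node
  /-- the number `t` of tolerated byzantine members, given the committee size `n` -/
  maxFaults : ℕ → ℕ
  genesisState : State
  genesisBlock : Block Tx Hash

/-! ### State service: execution of proposals -/

section Execution

variable {Node Tx State Receipt Hash : Type*} (P : Params Node Tx State Receipt Hash)

/-- Execute, in order, the transactions that are valid when their turn comes, and discard the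
others. Returns the final state, the receipts and the executed transactions. -/
def runTxs : State → List Tx → State × List Receipt × List Tx
  | S, [] => (S, [], [])
  | S, tx :: txs =>
    if P.isValid S tx then
      let o := P.run tx S
      let rest := runTxs o.1 txs
      (rest.1, o.2 :: rest.2.1, tx :: rest.2.2)
    else runTxs S txs

/-- The block created by executing proposal `m` in state `S` on top of the block `parent`. -/
def mkBlock (parent : Block Tx Hash) (S : State) (m : Proposal Tx) : Block Tx Hash where
  header :=
    { parentHash := P.headerHash parent.header
      stateHash := P.stateHash (runTxs P S m.txs).1
      txHash := P.txHash (runTxs P S m.txs).2.2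
      receiptHash := P.receiptHash (runTxs P S m.txs).2.1
      gasUsed := ((runTxs P S m.txs).2.1.map P.gas).sum
      gasLimit := P.gasLimit
      nonce := P.nonce
      timestamp := m.timestamp }
  txs := (runTxs P S m.txs).2.2

end Execution

/-! ### Local states -/

/-- Local state of one binary consensus. `round = 0` means that no input was given yet. -/
structure BinState where
  round : ℕ
  est : Bool
  coordSent : Bool
  auxSent : Bool
  decision : Option Bool

def BinState.initial : BinState := ⟨0, false, false, false, none⟩

/-- Local state of one consensus instance: reliable broadcasts and binary consensuses, one of each
for every member `k`. `props k` is the proposal reliably delivered from `k`, and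
`(bin k).decision` is the entry `k` of the bitmask. -/
structure InstState (Node Tx : Type*) where
  proposed : Bool
  echoed : Node → Bool
  readied : Node → Bool
  props : Node → Option (Proposal Tx)
  bin : Node → BinState

def InstState.initial (Node Tx : Type*) : InstState Node Tx :=
  ⟨false, fun _ => false, fun _ => false, fun _ => none, fun _ => BinState.initial⟩

/-- Local state of a node. -/
structure LocalState (Node Tx State Hash : Type*) where
  /-- current state of the virtual machine -/
  vm : State
  /-- the local chain of blocks, genesis block first -/
  chain : List (Block Tx Hash)
  mempool : Set Tx
  /-- index of the current consensus instance -/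
  cur : ℕ
  /-- committee of each instance `i ≤ cur` -/
  committee : ℕ → Finset Node
  /-- `none` while the superblock of instance `cur` is awaited, afterwards the
  part of this superblock that remains to be executed -/
  pending : Option (Superblock Tx)
  /-- received messages with their (authenticated) senders -/
  received : Set (Node × Msg Node Tx)
  inst : ℕ → InstState Node Tx

section Protocol

variable {Node Tx State Receipt Hash : Type*}

def LocalState.initial (P : Params Node Tx State Receipt Hash) : LocalState Node Tx State Hash where
  vm := P.genesisState
  chain := [P.genesisBlock]
  mempool := ∅
  cur := 0
  committee := fun _ => P.committee P.genesisState
  pending := none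
  received := ∅
  inst := fun _ => InstState.initial Node Tx

open Classical in
/-- The number of elements of `C` that satisfy `p`. -/
noncomputable def count (C : Finset Node) (p : Node → Prop) : ℕ := (C.filter p).card

/-- Size of the committee of instance `i`, as known locally. -/
def LocalState.n (l : LocalState Node Tx State Hash) (i : ℕ) : ℕ := (l.committee i).card

/-- Fault threshold of the committee of instance `i`. -/
def LocalState.t (P : Params Node Tx State Receipt Hash) (l : LocalState Node Tx State Hash)
    (i : ℕ) : ℕ := P.maxFaults (l.n i)

/-- The number of distinct committee members of instance `i` from which `m` was received. -/
noncomputable def LocalState.recvCount (l : LocalState Node Tx State Hash) (i : ℕ)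
    (m : Msg Node Tx) : ℕ := count (l.committee i) (fun a => (a, m) ∈ l.received)

/-- The variable `bin_values[r]` of binary consensus `k` of instance `i`: the values received in
`bval` messages of `2t + 1` distinct members. -/
def LocalState.binValues (P : Params Node Tx State Receipt Hash)
    (l : LocalState Node Tx State Hash) (i : ℕ) (k : Node) (r : ℕ) : Set Bool :=
  {v | 2 * l.t P i + 1 ≤ l.recvCount i (.bval i k r v)}

/-- The rotating weak coordinator of round `r ≥ 1`. -/
def LocalState.IsCoord [LinearOrder Node] (l : LocalState Node Tx State Hash) (i r : ℕ)
    (p : Node) : Prop :=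
  ((l.committee i).sort (· ≤ ·))[(r - 1) % l.n i]? = some p

/-- Node `p` takes part in instance `i`: the instance has started locally and `p` is a member of
its committee. -/
def LocalState.Active (l : LocalState Node Tx State Hash) (p : Node) (i : ℕ) : Prop :=
  i ≤ l.cur ∧ p ∈ l.committee i

open Classical in
noncomputable def LocalState.setInst (l : LocalState Node Tx State Hash) (i : ℕ)
    (s : InstState Node Tx) : LocalState Node Tx State Hash :=
  { l with inst := Function.update l.inst i s }

open Classical in
noncomputable def LocalState.setBin (l : LocalState Node Tx State Hash) (i : ℕ) (k : Node)
    (b : BinState) : LocalState Node Tx State Hash :=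
  l.setInst i { l.inst i with bin := Function.update (l.inst i).bin k b }

/-- `bitmask & props`, in the order of the members. -/
def LocalState.superblock [LinearOrder Node] (l : LocalState Node Tx State Hash) (i : ℕ) :
    Superblock Tx :=
  ((l.committee i).sort (· ≤ ·)).filterMap fun k =>
    if ((l.inst i).bin k).decision = some true then (l.inst i).props k else none

/-- The estimate after a round `r` that ended with the set of values `vals`: the element of `vals`
if it is unique, and the parity of the round otherwise. -/
def newEst (r : ℕ) (vals : Finset Bool) : Bool :=
  if vals = {true} then true else if vals = {false} then false else decide (r % 2 = 1)

/-- Decide when `vals` consists of the parity of the round, unless already done. -/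
def newDecision (r : ℕ) (vals : Finset Bool) (old : Option Bool) : Option Bool :=
  if old = none ∧ vals = {decide (r % 2 = 1)} then some (decide (r % 2 = 1)) else old

/-- `LocalStep P p l l' out`: the correct node `p` in local state `l` may move to `l'` and
broadcast the messages `out`. Timers may expire at any time. -/
inductive LocalStep [LinearOrder Node] (P : Params Node Tx State Receipt Hash) (p : Node) :
    LocalState Node Tx State Hash → LocalState Node Tx State Hash → Set (Msg Node Tx) → Prop
  /- Reception of a client transaction and creation of proposals. -/
  | client (l) (tx : Tx) (hv : P.isValid l.vm tx = true) :
      LocalStep P p l { l with mempool := insert tx l.mempool } ∅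
  | propose (l) (m : Proposal Tx) (ha : l.Active p l.cur)
      (hp : (l.inst l.cur).proposed = false)
      (hnd : m.txs.Nodup) (hm : ∀ tx, tx ∈ m.txs ↔ tx ∈ l.mempool) :
      LocalStep P p l
        { l.setInst l.cur { l.inst l.cur with proposed := true } with mempool := ∅ }
        {.init l.cur m}
  /- Reliable broadcast. -/
  | echo (l) (i : ℕ) (k : Node) (m : Proposal Tx) (ha : l.Active p i) (hk : k ∈ l.committee i)
      (hr : (k, Msg.init i m) ∈ l.received) (he : (l.inst i).echoed k = false) :
      LocalStep P p l
        (l.setInst i { l.inst i with echoed := Function.update (l.inst i).echoed k true })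
        {.echo i k m}
  | ready (l) (i : ℕ) (k : Node) (m : Proposal Tx) (ha : l.Active p i) (hk : k ∈ l.committee i)
      (hr : l.n i + l.t P i < 2 * l.recvCount i (.echo i k m) ∨
        l.t P i + 1 ≤ l.recvCount i (.ready i k m))
      (he : (l.inst i).readied k = false) :
      LocalStep P p l
        (l.setInst i { l.inst i with readied := Function.update (l.inst i).readied k true })
        {.ready i k m}
  | deliver (l) (i : ℕ) (k : Node) (m : Proposal Tx) (ha : l.Active p i) (hk : k ∈ l.committee i)
      (hr : 2 * l.t P i + 1 ≤ l.recvCount i (.ready i k m))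
      (hd : (l.inst i).props k = none) :
      LocalStep P p l
        (l.setInst i { l.inst i with props := Function.update (l.inst i).props k (some m) })
        ∅
  /- Inputs of the binary consensuses: 1 for a delivered proposal; 0 for a proposal that was not
  delivered, once `n - t` binary consensuses have decided 1. -/
  | input_one (l) (i : ℕ) (k : Node) (ha : l.Active p i) (hk : k ∈ l.committee i)
      (hs : ((l.inst i).bin k).round = 0) (hd : (l.inst i).props k ≠ none) :
      LocalStep P p l
        (l.setBin i k { (l.inst i).bin k with round := 1, est := true })
        {.bval i k 1 true}
  | input_zero (l) (i : ℕ) (k : Node) (ha : l.Active p i) (hk : k ∈ l.committee i)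
      (hs : ((l.inst i).bin k).round = 0) (hd : (l.inst i).props k = none)
      (hones : l.n i ≤
        count (l.committee i) (fun a => ((l.inst i).bin a).decision = some true) + l.t P i) :
      LocalStep P p l
        (l.setBin i k { (l.inst i).bin k with round := 1, est := false })
        {.bval i k 1 false}
  /- Binary consensus `k` of instance `i`. -/
  | bval_relay (l) (i : ℕ) (k : Node) (r : ℕ) (v : Bool) (ha : l.Active p i)
      (hk : k ∈ l.committee i) (hr : l.t P i + 1 ≤ l.recvCount i (.bval i k r v)) :
      LocalStep P p l l {.bval i k r v}
  | coordinate (l) (i : ℕ) (k : Node) (b : BinState) (w : Bool) (ha : l.Active p i)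
      (hk : k ∈ l.committee i) (hb : (l.inst i).bin k = b) (hs : 1 ≤ b.round)
      (hc : l.IsCoord i b.round p) (hns : b.coordSent = false)
      (hw : w ∈ l.binValues P i k b.round) :
      LocalStep P p l
        (l.setBin i k { b with coordSent := true })
        {.coord i k b.round w}
  | send_aux (l) (i : ℕ) (k : Node) (b : BinState) (s : Finset Bool) (ha : l.Active p i)
      (hk : k ∈ l.committee i) (hb : (l.inst i).bin k = b) (hs : 1 ≤ b.round)
      (hns : b.auxSent = false)
      (hne : (l.binValues P i k b.round).Nonempty)
      (haux :
        (∃ a w, l.IsCoord i b.round a ∧ (a, Msg.coord i k b.round w) ∈ l.received ∧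
          w ∈ l.binValues P i k b.round ∧ s = {w}) ∨
        ((¬ ∃ a w, l.IsCoord i b.round a ∧ (a, Msg.coord i k b.round w) ∈ l.received ∧
          w ∈ l.binValues P i k b.round) ∧ (s : Set Bool) = l.binValues P i k b.round)) :
      LocalStep P p l
        (l.setBin i k { b with auxSent := true })
        {.aux i k b.round s}
  /- `aux` messages with contents `f a` were received from the members `a ∈ Q`, at least `n - t`
  in number, and the union `vals` of the contents is non-empty and included in `bin_values`. -/
  | end_round (l) (i : ℕ) (k : Node) (b : BinState) (Q : Finset Node) (f : Node → Finset Bool)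
      (vals : Finset Bool) (ha : l.Active p i)
      (hk : k ∈ l.committee i) (hb : (l.inst i).bin k = b) (hs : 1 ≤ b.round)
      (hns : b.auxSent = true)
      (hQ : Q ⊆ l.committee i) (hcard : l.n i ≤ Q.card + l.t P i)
      (hf : ∀ a ∈ Q, (a, Msg.aux i k b.round (f a)) ∈ l.received)
      (hvals : vals = Q.biUnion f) (hne : vals.Nonempty)
      (hsub : (vals : Set Bool) ⊆ l.binValues P i k b.round) :
      LocalStep P p l
        (l.setBin i k
          { round := b.round + 1
            est := newEst b.round vals
            coordSent := false
            auxSent := false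
            decision := newDecision b.round vals b.decision })
        {.bval i k (b.round + 1) (newEst b.round vals)}
  /- End of the consensus at a committee member: the bitmask is full and all proposals that it
  selects have been delivered. -/
  | decide_superblock (l) (ha : l.Active p l.cur) (hp : l.pending = none)
      (hfull : ∀ k ∈ l.committee l.cur, ((l.inst l.cur).bin k).decision ≠ none)
      (hdel : ∀ k ∈ l.committee l.cur, ((l.inst l.cur).bin k).decision = some true →
        (l.inst l.cur).props k ≠ none) :
      LocalStep P p l { l with pending := some (l.superblock l.cur) }
        {.superblock l.cur (l.superblock l.cur)}
  /- A node outside the committee obtains the superblock from `t + 1` members. -/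
  | learn_superblock (l) (sb : Superblock Tx) (hna : p ∉ l.committee l.cur)
      (hp : l.pending = none)
      (hr : l.t P l.cur + 1 ≤ l.recvCount l.cur (.superblock l.cur sb)) :
      LocalStep P p l { l with pending := some sb } ∅
  /- Execution of the next proposal of the superblock: one block is appended. -/
  | exec_block (l) (m : Proposal Tx) (rest : Superblock Tx) (hp : l.pending = some (m :: rest)) :
      LocalStep P p l
        { l with
          vm := (runTxs P l.vm m.txs).1
          chain := l.chain ++ [mkBlock P (l.chain.getLastD P.genesisBlock) l.vm m]
          pending := some rest } ∅
  /- The superblock has been executed: move on to the next instance, with the committee that is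
  now recorded in the state. -/
  | next_instance (l) (hp : l.pending = some []) :
      LocalStep P p l
        { l with
          cur := l.cur + 1
          committee := Function.update l.committee (l.cur + 1) (P.committee l.vm)
          pending := none } ∅

/-! ### The distributed system -/

/-- A configuration: the local states (meaningful for correct nodes only) and the set of all
messages `(source, destination, message)` sent so far. -/
structure Config (Node Tx State Hash : Type*) where
  loc : Node → LocalState Node Tx State Hash
  net : Set (Node × Node × Msg Node Tx)

def Config.initial (P : Params Node Tx State Receipt Hash) : Config Node Tx State Hash :=
  ⟨fun _ => LocalState.initial P, ∅⟩

/-- One step of the asynchronous system with byzantine nodes `Byz`: a correct node takes a local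
step and broadcasts messages to all nodes; or a message that was sent to a correct node is received;
or a byzantine node sends an arbitrary message to an arbitrary node. Messages may be delayed
arbitrarily and reordered; the sender of a message cannot be forged. -/
inductive Step [LinearOrder Node] (P : Params Node Tx State Receipt Hash) (Byz : Set Node) :
    Config Node Tx State Hash → Config Node Tx State Hash → Prop
  | loc (c) (p : Node) (l' : LocalState Node Tx State Hash) (out : Set (Msg Node Tx))
      (hp : p ∉ Byz) (h : LocalStep P p (c.loc p) l' out) :
      Step P Byz c ⟨Function.update c.loc p l', c.net ∪ {e | e.1 = p ∧ e.2.2 ∈ out}⟩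
  | receive (c) (a p : Node) (m : Msg Node Tx) (hp : p ∉ Byz) (h : (a, p, m) ∈ c.net) :
      Step P Byz c
        ⟨Function.update c.loc p
          { c.loc p with received := insert (a, m) (c.loc p).received }, c.net⟩
  | byzantine (c) (a p : Node) (m : Msg Node Tx) (ha : a ∈ Byz) :
      Step P Byz c ⟨c.loc, insert (a, p, m) c.net⟩

/-- The fault assumption `f ≤ t < n / 3` for the current committee of every correct node. -/
def FaultBound (P : Params Node Tx State Receipt Hash) (Byz : Set Node)
    (c : Config Node Tx State Hash) : Prop :=
  ∀ p ∉ Byz,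
    count ((c.loc p).committee (c.loc p).cur) (· ∈ Byz) ≤ (c.loc p).t P (c.loc p).cur ∧
    3 * (c.loc p).t P (c.loc p).cur < (c.loc p).n (c.loc p).cur

/-- The configurations reached by the executions that respect the fault assumption. -/
inductive Reachable [LinearOrder Node] (P : Params Node Tx State Receipt Hash) (Byz : Set Node) :
    Config Node Tx State Hash → Prop
  | initial : Reachable P Byz (Config.initial P)
  | step (c c' : Config Node Tx State Hash) (hc : Reachable P Byz c) (hf : FaultBound P Byz c)
      (h : Step P Byz c c') : Reachable P Byz c'

end Protocol

end SocChain

/-! The set of sent messages only grows, so a fact of the form "enough members have sent these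
messages" persists. The proof replaces local knowledge by such evidence (`EchoQuorum`, `RoundEnd`,
`BinDecided`, `SuperblockDecided`). `Invariant` says that deliveries, decisions and superblocks of
correct nodes are backed by evidence and that correct nodes never equivocate in ECHO or AUX. Every
step preserves it without any agreement being known; agreement is then derived inside one fixed
configuration.

Two echo quorums share more than t members, hence a correct one, so deliveries agree
(`EchoQuorum.agreement`). Suppose that round r can end with v alone, where v is the parity of r. Two
sets of n - t AUX senders share at least n - 2t > t members, so every possible end of round r has v
among its values, and the new estimate is v, either as the unique value or as the default. In later
rounds a value needs a BVAL from a correct member, so only v survives (`RoundEnd.bval_eq`). Hence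
decisions agree, and so do superblocks, provided that the committee is common.

The committee depends on the past, which calls for an induction on the instance
(`StateBefore.unique`): a unique state before instance i gives one committee, hence one superblock,
hence a unique state before i + 1. All local chains are thus initial parts of the execution of a
single sequence of superblocks, and two prefixes of one list are comparable. -/

namespace SocChain

/-! ### Counting members: quorum intersection -/

section Counting

variable {Node : Type*}

theorem count_mono {C : Finset Node} {p q : Node → Prop} (h : ∀ a ∈ C, p a → q a) :
    count C p ≤ count C q := by
  classical
  unfold count
  refine Finset.card_le_card fun a ha => ?_
  rw [Finset.mem_filter] at ha ⊢
  exact ⟨ha.1, h a ha.1 ha.2⟩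

theorem exists_of_count_lt {C : Finset Node} {p q : Node → Prop} (h : count C p < count C q) :
    ∃ a ∈ C, q a ∧ ¬ p a := by
  by_contra hcon
  push Not at hcon
  exact absurd (count_mono hcon) (by omega)

/-- Inclusion-exclusion, the source of both quorum intersections. Combined with
`exists_of_count_lt`, it produces a correct member common to two quorums. -/
theorem count_add_count_le (C : Finset Node) (p q : Node → Prop) :
    count C p + count C q ≤ C.card + count C (fun a => p a ∧ q a) := by
  classical
  have hand : count C (fun a => p a ∧ q a) = (C.filter p ∩ C.filter q).card := by
    unfold count
    congr 1
    ext a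
    simp only [Finset.mem_filter, Finset.mem_inter]
    tauto
  rw [hand]
  unfold count
  rw [← Finset.card_union_add_card_inter, Nat.add_le_add_iff_right]
  exact Finset.card_le_card
    (Finset.union_subset (Finset.filter_subset _ _) (Finset.filter_subset _ _))

theorem card_le_count {C Q : Finset Node} {p : Node → Prop} (hQ : Q ⊆ C) (h : ∀ a ∈ Q, p a) :
    Q.card ≤ count C p := by
  classical
  unfold count
  refine Finset.card_le_card fun a ha => ?_
  rw [Finset.mem_filter]
  exact ⟨hQ ha, h a ha⟩

end Counting

/-! ### Evidence carried by the sent messages, and the invariant -/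

section Evidence

variable {Node Tx State Receipt Hash : Type*}

/-- Node `a` has sent `m` to some node. -/
def Config.Sent (c : Config Node Tx State Hash) (a : Node) (m : Msg Node Tx) : Prop :=
  ∃ d, (a, d, m) ∈ c.net

/-- The fault assumption for the committee `C`. -/
def GoodCommittee (P : Params Node Tx State Receipt Hash) (Byz : Set Node)
    (C : Finset Node) : Prop :=
  count C (· ∈ Byz) ≤ P.maxFaults C.card ∧ 3 * P.maxFaults C.card < C.card

/-- `C` satisfies the fault assumption and is the committee of instance `i` for a correct node. -/
def InstCommittee (P : Params Node Tx State Receipt Hash) (Byz : Set Node)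
    (c : Config Node Tx State Hash) (i : ℕ) (C : Finset Node) : Prop :=
  GoodCommittee P Byz C ∧ ∃ q ∉ Byz, i ≤ (c.loc q).cur ∧ (c.loc q).committee i = C

/-- A quorum of members has sent `echo i k m`. -/
def EchoQuorum (P : Params Node Tx State Receipt Hash) (Byz : Set Node)
    (c : Config Node Tx State Hash) (i : ℕ) (k : Node) (m : Proposal Tx) : Prop :=
  ∃ C, InstCommittee P Byz c i C ∧
    C.card + P.maxFaults C.card < 2 * count C (fun a => c.Sent a (.echo i k m))

/-- The messages sent so far allow round `r` of binary consensus `k` to end with the set of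
values `vals`. -/
def RoundEnd (P : Params Node Tx State Receipt Hash) (Byz : Set Node)
    (c : Config Node Tx State Hash) (i : ℕ) (k : Node) (r : ℕ) (vals : Finset Bool) : Prop :=
  1 ≤ r ∧ vals.Nonempty ∧ (∀ w ∈ vals, ∃ a ∉ Byz, c.Sent a (.bval i k r w)) ∧
    ∃ C, InstCommittee P Byz c i C ∧
      C.card ≤ count C (fun a => ∃ s ⊆ vals, c.Sent a (.aux i k r s)) + P.maxFaults C.card

/-- The messages sent so far allow binary consensus `k` to decide `v`. -/
def BinDecided (P : Params Node Tx State Receipt Hash) (Byz : Set Node)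
    (c : Config Node Tx State Hash) (i : ℕ) (k : Node) (v : Bool) : Prop :=
  ∃ r, v = decide (r % 2 = 1) ∧ RoundEnd P Byz c i k r {v}

/-- The messages sent so far allow instance `i` to produce the superblock `sb`. -/
def SuperblockDecided [LinearOrder Node] (P : Params Node Tx State Receipt Hash) (Byz : Set Node)
    (c : Config Node Tx State Hash) (i : ℕ) (sb : Superblock Tx) : Prop :=
  ∃ (C : Finset Node) (D : Node → Option Bool) (props : Node → Option (Proposal Tx)),
    InstCommittee P Byz c i C ∧
    (∀ k ∈ C, ∃ v, D k = some v ∧ BinDecided P Byz c i k v) ∧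
    (∀ k ∈ C, D k = some true → ∃ m, props k = some m ∧ EchoQuorum P Byz c i k m) ∧
    sb = (C.sort (· ≤ ·)).filterMap fun k => if D k = some true then props k else none

/-- What the sending of a message by a correct node entails. -/
def Justified [LinearOrder Node] (P : Params Node Tx State Receipt Hash) (Byz : Set Node)
    (c : Config Node Tx State Hash) : Msg Node Tx → Prop
  | .ready i k m => EchoQuorum P Byz c i k m
  | .bval i k r v => 2 ≤ r → ∃ vals, RoundEnd P Byz c i k (r - 1) vals ∧ v = newEst (r - 1) vals
  | .aux _ _ _ s => s.Nonempty
  | .superblock i sb => SuperblockDecided P Byz c i sb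
  | _ => True

/-- The local state records that an `echo` or `aux` message like the given one was sent. -/
def LocalState.Recorded (l : LocalState Node Tx State Hash) : Msg Node Tx → Prop
  | .echo i k _ => (l.inst i).echoed k = true
  | .aux i k r _ => r < ((l.inst i).bin k).round ∨
      (r = ((l.inst i).bin k).round ∧ ((l.inst i).bin k).auxSent = true)
  | _ => True

/-- Two `echo` messages, or two `aux` messages, that a correct node sends at most one of. -/
inductive Exclusive : Msg Node Tx → Msg Node Tx → Prop
  | echo (i k m m') : Exclusive (.echo i k m) (.echo i k m')
  | aux (i k r s s') : Exclusive (.aux i k r s) (.aux i k r s')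

/-- Execution of one proposal: the new state and the new chain. -/
def execProposal (P : Params Node Tx State Receipt Hash) (s : State × List (Block Tx Hash))
    (m : Proposal Tx) : State × List (Block Tx Hash) :=
  ((runTxs P s.1 m.txs).1, s.2 ++ [mkBlock P (s.2.getLastD P.genesisBlock) s.1 m])

def execProposals (P : Params Node Tx State Receipt Hash) (s : State × List (Block Tx Hash))
    (sb : Superblock Tx) : State × List (Block Tx Hash) :=
  sb.foldl (execProposal P) s

theorem execProposals_append (P : Params Node Tx State Receipt Hash)
    (s : State × List (Block Tx Hash)) (sb sb' : Superblock Tx) :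
    execProposals P s (sb ++ sb') = execProposals P (execProposals P s sb) sb' :=
  List.foldl_append

theorem prefix_execProposals (P : Params Node Tx State Receipt Hash)
    (s : State × List (Block Tx Hash)) (sb : Superblock Tx) :
    s.2 <+: (execProposals P s sb).2 := by
  induction sb generalizing s with
  | nil => exact List.prefix_rfl
  | cons m sb ih => exact (List.prefix_append _ _).trans (ih (execProposal P s m))

/-- A correct node has broadcast `sb` as the superblock of instance `i`. -/
def Announced (Byz : Set Node) (c : Config Node Tx State Hash) (i : ℕ)
    (sb : Superblock Tx) : Prop :=
  ∃ a ∉ Byz, c.Sent a (.superblock i sb)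

/-- `s` is a state and a chain obtained by executing announced superblocks of the instances
before `i`. -/
inductive StateBefore (P : Params Node Tx State Receipt Hash) (Byz : Set Node)
    (c : Config Node Tx State Hash) : ℕ → State × List (Block Tx Hash) → Prop
  | zero : StateBefore P Byz c 0 (P.genesisState, [P.genesisBlock])
  | succ (i s sb) (hs : StateBefore P Byz c i s) (hsb : Announced Byz c i sb) :
      StateBefore P Byz c (i + 1) (execProposals P s sb)

/-- Cuts a history at instance `i`, since executing superblocks only appends blocks. This serves to
compare a node still in instance `i` with one that has left it. -/
theorem StateBefore.exists_prefix {P : Params Node Tx State Receipt Hash} {Byz : Set Node}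
    {c : Config Node Tx State Hash} {i j : ℕ} {s : State × List (Block Tx Hash)}
    (h : StateBefore P Byz c j s) (hij : i < j) : ∃ s' sb, StateBefore P Byz c i s' ∧
      Announced Byz c i sb ∧ (execProposals P s' sb).2 <+: s.2 := by
  induction h with
  | zero => omega
  | succ j s sb hs hsb ih =>
    rcases Nat.lt_succ_iff_lt_or_eq.1 hij with hlt | rfl
    · obtain ⟨s', sb', hs', hsb', hp⟩ := ih hlt
      exact ⟨s', sb', hs', hsb', hp.trans (prefix_execProposals P s sb)⟩
    · exact ⟨s, sb, hs, hsb, List.prefix_rfl⟩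

/-- The part of the invariant that concerns the consensus instances of one correct node. -/
structure InstInvariant (P : Params Node Tx State Receipt Hash) (Byz : Set Node)
    (c : Config Node Tx State Hash) (l : LocalState Node Tx State Hash) : Prop where
  props : ∀ i k m, (l.inst i).props k = some m → EchoQuorum P Byz c i k m
  decision : ∀ i k v, ((l.inst i).bin k).decision = some v → BinDecided P Byz c i k v

/-- The part of the invariant that concerns the chain of one correct node. -/
structure ChainInvariant (P : Params Node Tx State Receipt Hash) (Byz : Set Node)
    (c : Config Node Tx State Hash) (l : LocalState Node Tx State Hash) : Prop where
  good : ∀ i < l.cur, GoodCommittee P Byz (l.committee i)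
  committee : ∀ i ≤ l.cur, ∃ s, StateBefore P Byz c i s ∧ l.committee i = P.committee s.1
  exec : ∃ s done, StateBefore P Byz c l.cur s ∧ (l.vm, l.chain) = execProposals P s done ∧
    (l.pending = none → done = []) ∧
    ∀ rest, l.pending = some rest → Announced Byz c l.cur (done ++ rest)

/-- `recorded` is what makes `unique` inductive: the local flags remember past ECHO and AUX messages
and so block a second one. Agreement is deliberately absent; it follows from these fields in a
single configuration. -/
structure Invariant [LinearOrder Node] (P : Params Node Tx State Receipt Hash) (Byz : Set Node)
    (c : Config Node Tx State Hash) : Prop where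
  justified : ∀ a ∉ Byz, ∀ m, c.Sent a m → Justified P Byz c m
  recorded : ∀ a ∉ Byz, ∀ m, c.Sent a m → (c.loc a).Recorded m
  unique : ∀ a ∉ Byz, ∀ m m', c.Sent a m → c.Sent a m' → Exclusive m m' → m = m'
  received : ∀ p ∉ Byz, ∀ a m, (a, m) ∈ (c.loc p).received → c.Sent a m
  inst : ∀ p ∉ Byz, InstInvariant P Byz c (c.loc p)
  chain : ∀ p ∉ Byz, ChainInvariant P Byz c (c.loc p)

end Evidence

/-! ### Persistence of evidence as the configuration grows -/

section Monotonicity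

variable {Node Tx State Receipt Hash : Type*} {P : Params Node Tx State Receipt Hash}
  {Byz : Set Node} {c c' : Config Node Tx State Hash}

/-- `c'` extends `c`: messages and committees of started instances persist. -/
structure Extends (P : Params Node Tx State Receipt Hash) (Byz : Set Node)
    (c c' : Config Node Tx State Hash) : Prop where
  sent : ∀ {a m}, c.Sent a m → c'.Sent a m
  committee : ∀ {i C}, InstCommittee P Byz c i C → InstCommittee P Byz c' i C

theorem Extends.of_loc (hnet : c.net ⊆ c'.net)
    (hloc : ∀ q ∉ Byz, (c.loc q).cur ≤ (c'.loc q).cur ∧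
      ∀ i ≤ (c.loc q).cur, (c'.loc q).committee i = (c.loc q).committee i) :
    Extends P Byz c c' := by
  refine ⟨fun ⟨d, hd⟩ => ⟨d, hnet hd⟩, fun ⟨hg, q, hq, hi, hC⟩ => ⟨hg, q, hq, ?_, ?_⟩⟩
  · exact hi.trans (hloc q hq).1
  · rw [(hloc q hq).2 _ hi, hC]

theorem EchoQuorum.mono (h : Extends P Byz c c') {i k m} (he : EchoQuorum P Byz c i k m) :
    EchoQuorum P Byz c' i k m := by
  obtain ⟨C, hC, hq⟩ := he
  have := count_mono (C := C) (p := fun a => c.Sent a (.echo i k m))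
    (q := fun a => c'.Sent a (.echo i k m)) fun a _ => h.sent
  exact ⟨C, h.committee hC, by omega⟩

theorem RoundEnd.mono (h : Extends P Byz c c') {i k r vals} (he : RoundEnd P Byz c i k r vals) :
    RoundEnd P Byz c' i k r vals := by
  obtain ⟨hr, hne, hb, C, hC, hq⟩ := he
  refine ⟨hr, hne, fun w hw => ?_, C, h.committee hC, hq.trans (Nat.add_le_add_right ?_ _)⟩
  · obtain ⟨a, ha, hs⟩ := hb w hw
    exact ⟨a, ha, h.sent hs⟩
  · exact count_mono fun a _ ⟨s, hs, hsent⟩ => ⟨s, hs, h.sent hsent⟩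

theorem BinDecided.mono (h : Extends P Byz c c') {i k v} (he : BinDecided P Byz c i k v) :
    BinDecided P Byz c' i k v := by
  obtain ⟨r, hv, hr⟩ := he
  exact ⟨r, hv, hr.mono h⟩

theorem SuperblockDecided.mono [LinearOrder Node] (h : Extends P Byz c c') {i sb}
    (he : SuperblockDecided P Byz c i sb) : SuperblockDecided P Byz c' i sb := by
  obtain ⟨C, D, props, hC, hD, hp, hsb⟩ := he
  refine ⟨C, D, props, h.committee hC, fun k hk => ?_, fun k hk hk1 => ?_, hsb⟩
  · obtain ⟨v, hv, hd⟩ := hD k hk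
    exact ⟨v, hv, hd.mono h⟩
  · obtain ⟨m, hm, he⟩ := hp k hk hk1
    exact ⟨m, hm, he.mono h⟩

theorem Justified.mono [LinearOrder Node] (h : Extends P Byz c c') {m}
    (hm : Justified P Byz c m) : Justified P Byz c' m := by
  cases m with
  | ready i k m => exact EchoQuorum.mono h hm
  | bval i k r v =>
    intro hr
    obtain ⟨vals, hv, he⟩ := hm hr
    exact ⟨vals, hv.mono h, he⟩
  | superblock i sb => exact SuperblockDecided.mono h hm
  | aux i k r s => exact hm
  | _ => trivial

theorem Announced.mono (h : Extends P Byz c c') {i sb} (ha : Announced Byz c i sb) :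
    Announced Byz c' i sb := by
  obtain ⟨a, ha, hs⟩ := ha
  exact ⟨a, ha, h.sent hs⟩

theorem StateBefore.mono (h : Extends P Byz c c') {i s} (hs : StateBefore P Byz c i s) :
    StateBefore P Byz c' i s := by
  induction hs with
  | zero => exact .zero
  | succ i s sb _ hsb ih => exact .succ i s sb ih (hsb.mono h)

theorem InstInvariant.mono (h : Extends P Byz c c') {l} (hl : InstInvariant P Byz c l) :
    InstInvariant P Byz c' l :=
  ⟨fun i k m hm => (hl.props i k m hm).mono h, fun i k v hv => (hl.decision i k v hv).mono h⟩

theorem ChainInvariant.mono (h : Extends P Byz c c') {l} (hl : ChainInvariant P Byz c l) :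
    ChainInvariant P Byz c' l := by
  obtain ⟨hg, hc, s, done, hs, he, hn, hr⟩ := hl
  refine ⟨hg, fun i hi => ?_, s, done, hs.mono h, he, hn, fun rest hrest => (hr rest hrest).mono h⟩
  obtain ⟨s, hs, hC⟩ := hc i hi
  exact ⟨s, hs.mono h, hC⟩

end Monotonicity

/-! ### Preservation of the invariant by the local steps -/

section LocalSteps

variable {Node Tx State Receipt Hash : Type*} {P : Params Node Tx State Receipt Hash}
  {Byz : Set Node} {c c' : Config Node Tx State Hash}
  {l l' : LocalState Node Tx State Hash} {p : Node} {out : Set (Msg Node Tx)}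

open Classical in
theorem LocalState.inst_setInst (i j : ℕ) (s : InstState Node Tx) :
    (l.setInst i s).inst j = if j = i then s else l.inst j := by
  simp [LocalState.setInst, Function.update_apply]

open Classical in
theorem LocalState.bin_setBin (i j : ℕ) (k k' : Node) (b : BinState) :
    ((l.setBin i k b).inst j).bin k' = if j = i ∧ k' = k then b else (l.inst j).bin k' := by
  simp only [LocalState.setBin, LocalState.inst_setInst]
  by_cases hj : j = i
  · subst hj
    simp [Function.update_apply]
  · simp [hj]

theorem LocalState.props_setBin (i j : ℕ) (k : Node) (b : BinState) :
    ((l.setBin i k b).inst j).props = (l.inst j).props := by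
  simp only [LocalState.setBin, LocalState.inst_setInst]
  split_ifs with h <;> simp [h]

theorem LocalState.echoed_setBin (i j : ℕ) (k : Node) (b : BinState) :
    ((l.setBin i k b).inst j).echoed = (l.inst j).echoed := by
  simp only [LocalState.setBin, LocalState.inst_setInst]
  split_ifs with h <;> simp [h]

theorem LocalStep.cur_le [LinearOrder Node] (h : LocalStep P p l l' out) : l.cur ≤ l'.cur := by
  cases h <;> first | exact le_rfl | exact Nat.le_succ _

theorem LocalStep.committee_eq [LinearOrder Node] (h : LocalStep P p l l' out) {i : ℕ}
    (hi : i ≤ l.cur) : l'.committee i = l.committee i := by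
  cases h with
  | next_instance => exact Function.update_of_ne (by omega) _ _
  | _ => rfl

theorem LocalStep.received_eq [LinearOrder Node] (h : LocalStep P p l l' out) :
    l'.received = l.received := by
  cases h <;> rfl

/-- More members than the fault threshold have sent `m`, hence a correct one has. -/
theorem exists_correct_sent {C : Finset Node} {m : Msg Node Tx} (hC : GoodCommittee P Byz C)
    (hrecv : ∀ a, (a, m) ∈ l.received → c.Sent a m)
    (h : P.maxFaults C.card + 1 ≤ count C (fun a => (a, m) ∈ l.received)) :
    ∃ a ∉ Byz, c.Sent a m := by
  obtain ⟨a, _, ha, hb⟩ := exists_of_count_lt (lt_of_le_of_lt hC.1 h)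
  exact ⟨a, hb, hrecv a ha⟩

/-- The flag `auxSent` may be reset only if the round advances, because past rounds are recorded by
the round number alone. -/
theorem LocalState.Recorded.setBin {i : ℕ} {k : Node} {b : BinState}
    (hb : ((l.inst i).bin k).round < b.round ∨ ((l.inst i).bin k).round = b.round ∧
      (((l.inst i).bin k).auxSent = true → b.auxSent = true))
    {m : Msg Node Tx} (hm : l.Recorded m) : (l.setBin i k b).Recorded m := by
  cases m with
  | echo j k' m =>
    simp only [LocalState.Recorded, LocalState.echoed_setBin]
    exact hm
  | aux j k' r s =>
    simp only [LocalState.Recorded, LocalState.bin_setBin] at hm ⊢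
    split_ifs with hjk
    · obtain ⟨rfl, rfl⟩ := hjk
      rcases hb with hb | ⟨hb, hb'⟩
      · exact .inl (by omega)
      · exact hm.imp (fun h => by omega) fun h => ⟨by omega, hb' h.2⟩
    · exact hm
  | _ => trivial

theorem LocalState.Recorded.setInst {i : ℕ} {s : InstState Node Tx}
    (he : ∀ k, (l.inst i).echoed k = true → s.echoed k = true) (hb : s.bin = (l.inst i).bin)
    {m : Msg Node Tx} (hm : l.Recorded m) : (l.setInst i s).Recorded m := by
  cases m with
  | echo j k m =>
    simp only [LocalState.Recorded, LocalState.inst_setInst] at hm ⊢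
    split_ifs with hj
    · subst hj
      exact he k hm
    · exact hm
  | aux j k r t =>
    simp only [LocalState.Recorded, LocalState.inst_setInst] at hm ⊢
    split_ifs with hj
    · subst hj
      rwa [hb]
    · exact hm
  | _ => trivial

theorem LocalState.Recorded.of_inst_eq (h : l'.inst = l.inst) {m : Msg Node Tx}
    (hm : l.Recorded m) : l'.Recorded m := by
  cases m with
  | echo | aux => simpa only [LocalState.Recorded, h] using hm
  | _ => trivial

theorem LocalState.Recorded.step [LinearOrder Node] (h : LocalStep P p l l' out)
    {m : Msg Node Tx} (hm : l.Recorded m) : l'.Recorded m := by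
  cases h with
  | client | bval_relay | decide_superblock | learn_superblock | exec_block | next_instance =>
    exact hm.of_inst_eq rfl
  | propose =>
    exact (hm.setInst (i := l.cur) (s := { l.inst l.cur with proposed := true })
      (fun _ => id) rfl).of_inst_eq rfl
  | ready | deliver =>
    exact hm.setInst (by exact fun _ => id) (by rfl)
  | echo i k =>
    refine hm.setInst ?_ (by rfl)
    intro k' hk'
    simp only [Function.update_apply]
    split_ifs
    · rfl
    · exact hk'
  | input_one i k ha hk hs | input_zero i k ha hk hs =>
    exact hm.setBin (.inl (hs.trans_lt one_pos))
  | coordinate i k b w ha hk hb =>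
    subst hb
    refine hm.setBin (.inr ?_)
    exact ⟨rfl, id⟩
  | send_aux i k b s ha hk hb =>
    subst hb
    refine hm.setBin (.inr ?_)
    exact ⟨rfl, fun _ => rfl⟩
  | end_round i k b Q f vals ha hk hb =>
    subst hb
    exact hm.setBin (.inl (Nat.lt_succ_self _))

theorem LocalStep.recorded_of_mem [LinearOrder Node] (h : LocalStep P p l l' out)
    {m : Msg Node Tx} (hm : m ∈ out) : l'.Recorded m := by
  cases h with
  | client | deliver | learn_superblock | exec_block | next_instance => exact absurd hm id
  | echo i k =>
    obtain rfl := hm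
    simp [LocalState.Recorded, LocalState.inst_setInst]
  | send_aux i k =>
    obtain rfl := hm
    simp [LocalState.Recorded, LocalState.bin_setBin]
  | _ =>
    obtain rfl := hm
    trivial

/-- The messages that a step broadcasts exclude neither each other nor a recorded message. -/
theorem LocalStep.eq_of_exclusive [LinearOrder Node] (h : LocalStep P p l l' out)
    {m m' : Msg Node Tx} (hm : m ∈ out) (hm' : m' ∈ out ∨ l.Recorded m') (he : Exclusive m m') :
    m = m' := by
  cases h with
  | client | deliver | learn_superblock | exec_block | next_instance => exact absurd hm id
  | echo i k m₀ ha hk hr hf =>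
    obtain rfl := hm
    rcases hm' with rfl | hm'
    · rfl
    · cases he
      exact absurd (hf.symm.trans hm') Bool.false_ne_true
  | send_aux i k b s ha hk hb hs hns =>
    obtain rfl := hm
    subst hb
    rcases hm' with rfl | hm'
    · rfl
    · cases he
      rcases hm' with hlt | ⟨_, ht⟩
      · exact absurd hlt (lt_irrefl _)
      · exact absurd (hns.symm.trans ht) Bool.false_ne_true
  | _ =>
    obtain rfl := hm
    cases he

/-- Turns the local condition for ending a round into global evidence. Each content `f a` is only a
subset of the union, which is why `RoundEnd` counts AUX messages with contents `s ⊆ vals`. -/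
theorem roundEnd_of_received {i r : ℕ} {k : Node} {Q : Finset Node}
    {f : Node → Finset Bool}
    (hC : InstCommittee P Byz c i (l.committee i))
    (hrecv : ∀ a m, (a, m) ∈ l.received → c.Sent a m)
    (hs : 1 ≤ r) (hQ : Q ⊆ l.committee i) (hcard : l.n i ≤ Q.card + l.t P i)
    (hf : ∀ a ∈ Q, (a, Msg.aux i k r (f a)) ∈ l.received)
    (hne : (Q.biUnion f).Nonempty)
    (hsub : ((Q.biUnion f : Finset Bool) : Set Bool) ⊆ l.binValues P i k r) :
    RoundEnd P Byz c i k r (Q.biUnion f) := by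
  refine ⟨hs, hne, fun w hw => ?_, l.committee i, hC, hcard.trans (Nat.add_le_add_right ?_ _)⟩
  -- Of the 2t + 1 senders, t + 1 are enough to include a correct one.
  · have h2 : 2 * P.maxFaults (l.committee i).card + 1 ≤ _ := hsub (Finset.mem_coe.2 hw)
    refine exists_correct_sent hC.1 (fun a => hrecv a _) (le_trans ?_ h2)
    omega
  · exact card_le_count hQ fun a ha =>
      ⟨f a, Finset.subset_biUnion_of_mem f ha, hrecv a _ (hf a ha)⟩

theorem InstInvariant.setBin (hI : InstInvariant P Byz c l) {i : ℕ} {k : Node}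
    {b : BinState} (hb : ∀ v, b.decision = some v → BinDecided P Byz c i k v) :
    InstInvariant P Byz c (l.setBin i k b) := by
  refine ⟨fun j k' m hm => hI.props j k' m ?_, fun j k' v hv => ?_⟩
  · rwa [LocalState.props_setBin] at hm
  · rw [LocalState.bin_setBin] at hv
    split_ifs at hv with hjk
    · obtain ⟨rfl, rfl⟩ := hjk
      exact hb v hv
    · exact hI.decision j k' v hv

theorem InstInvariant.setInst (hI : InstInvariant P Byz c l) {i : ℕ}
    {s : InstState Node Tx} (hp : ∀ k m, s.props k = some m → EchoQuorum P Byz c i k m)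
    (hb : s.bin = (l.inst i).bin) :
    InstInvariant P Byz c (l.setInst i s) := by
  refine ⟨fun j k m hm => ?_, fun j k v hv => ?_⟩
  · rw [LocalState.inst_setInst] at hm
    split_ifs at hm with hj
    · subst hj
      exact hp k m hm
    · exact hI.props j k m hm
  · refine hI.decision j k v ?_
    rw [LocalState.inst_setInst] at hv
    split_ifs at hv with hj
    · subst hj
      rwa [hb] at hv
    · exact hv

theorem InstInvariant.step [LinearOrder Node] (h : LocalStep P p l l' out)
    (hC : ∀ i ≤ l.cur, InstCommittee P Byz c i (l.committee i))
    (hrecv : ∀ a m, (a, m) ∈ l.received → c.Sent a m)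
    (hjust : ∀ a ∉ Byz, ∀ m, c.Sent a m → Justified P Byz c m)
    (hI : InstInvariant P Byz c l) : InstInvariant P Byz c l' := by
  cases h with
  | client | bval_relay | decide_superblock | learn_superblock | exec_block | next_instance =>
    exact ⟨hI.props, hI.decision⟩
  | propose =>
    have := hI.setInst (i := l.cur) (s := { l.inst l.cur with proposed := true })
      (hI.props l.cur) rfl
    exact ⟨this.props, this.decision⟩
  | echo i | ready i => exact hI.setInst (hI.props i) rfl
  | deliver i k m ha hk hr hd =>
    refine hI.setInst (fun k' m' hm => ?_) rfl
    simp only [Function.update_apply] at hm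
    split_ifs at hm with hk'
    · obtain rfl := Option.some.inj hm
      subst hk'
      -- One correct READY suffices here: its justification already is an echo quorum.
      have h2 : 2 * P.maxFaults (l.committee i).card + 1 ≤ _ := hr
      obtain ⟨a, ha', hs⟩ := exists_correct_sent (hC i ha.1).1 (fun a => hrecv a _)
        (le_trans (by omega) h2)
      exact hjust a ha' _ hs
    · exact hI.props i k' m' hm
  | input_one i k => exact hI.setBin (hI.decision i k)
  | input_zero i k => exact hI.setBin (hI.decision i k)
  | coordinate i k b w ha hk hb =>
    subst hb
    exact hI.setBin (hI.decision i k)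
  | send_aux i k b s ha hk hb =>
    subst hb
    exact hI.setBin (hI.decision i k)
  | end_round i k b Q f vals ha hk hb hs hns hQ hcard hf hvals hne hsub =>
    subst hb hvals
    refine hI.setBin fun v hv => ?_
    simp only [newDecision] at hv
    split_ifs at hv with hd
    · obtain rfl := Option.some.inj hv
      exact ⟨_, rfl, hd.2 ▸ roundEnd_of_received (hC i ha.1) hrecv hs hQ hcard hf hne hsub⟩
    · exact hI.decision i k v hv

/-- Relayed messages (READY after t + 1 READY, relayed BVAL) inherit the justification of a correct
earlier sender. The other cases read it off the local state. First-round BVAL messages need none: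
agreement does not depend on the inputs. -/
theorem LocalStep.justified [LinearOrder Node] (h : LocalStep P p l l' out)
    (hC : ∀ i ≤ l.cur, InstCommittee P Byz c i (l.committee i))
    (hrecv : ∀ a m, (a, m) ∈ l.received → c.Sent a m)
    (hjust : ∀ a ∉ Byz, ∀ m, c.Sent a m → Justified P Byz c m)
    (hI : InstInvariant P Byz c l) {m : Msg Node Tx} (hm : m ∈ out) : Justified P Byz c m := by
  cases h with
  | client | deliver | learn_superblock | exec_block | next_instance => exact absurd hm id
  | propose | echo | coordinate =>
    obtain rfl := hm
    trivial
  | ready i k m ha hk hr he =>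
    obtain rfl := hm
    rcases hr with hr | hr
    · refine ⟨l.committee i, hC i ha.1, lt_of_lt_of_le hr (Nat.mul_le_mul_left _ ?_)⟩
      exact count_mono fun a _ => hrecv a _
    · obtain ⟨a, ha', hs⟩ := exists_correct_sent (hC i ha.1).1 (fun a => hrecv a _) hr
      exact hjust a ha' _ hs
  | input_one | input_zero =>
    obtain rfl := hm
    intro h2
    omega
  | bval_relay i k r v ha hk hr =>
    obtain rfl := hm
    obtain ⟨a, ha', hs⟩ := exists_correct_sent (hC i ha.1).1 (fun a => hrecv a _) hr
    exact hjust a ha' _ hs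
  | send_aux i k b s ha hk hb hs hns hne haux =>
    obtain rfl := hm
    rcases haux with ⟨a, w, _, _, _, rfl⟩ | ⟨_, hs'⟩
    · exact Finset.singleton_nonempty w
    · exact Finset.coe_nonempty.1 (hs' ▸ hne)
  | end_round i k b Q f vals ha hk hb hs hns hQ hcard hf hvals hne hsub =>
    obtain rfl := hm
    subst hvals
    exact fun _ => ⟨_, roundEnd_of_received (hC i ha.1) hrecv hs hQ hcard hf hne hsub, rfl⟩
  | decide_superblock ha hp hfull hdel =>
    obtain rfl := hm
    refine ⟨l.committee l.cur, fun k => ((l.inst l.cur).bin k).decision, (l.inst l.cur).props,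
      hC _ le_rfl, fun k hk => ?_, fun k hk hd => ?_, rfl⟩
    · obtain ⟨v, hv⟩ := Option.ne_none_iff_exists'.1 (hfull k hk)
      exact ⟨v, hv, hI.decision _ _ _ hv⟩
    · obtain ⟨m, hm⟩ := Option.ne_none_iff_exists'.1 (hdel k hk hd)
      exact ⟨m, hm, hI.props _ _ _ hm⟩

theorem ChainInvariant.of_eq (hI : ChainInvariant P Byz c l) (hcur : l'.cur = l.cur)
    (hcom : l'.committee = l.committee) (hvm : l'.vm = l.vm) (hch : l'.chain = l.chain)
    (hpend : l'.pending = l.pending) : ChainInvariant P Byz c l' := by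
  obtain ⟨hg, hc, he⟩ := hI
  exact ⟨by rwa [hcur, hcom], by rwa [hcur, hcom], by rwa [hcur, hvm, hch, hpend]⟩

/-- The announced superblock is split into an executed part `done` and the pending rest, and
executing a block moves one proposal across. When the rest is empty, `done` is the whole superblock
and the history gains an instance. -/
theorem ChainInvariant.step [LinearOrder Node] (h : LocalStep P p l l' out) (hp : p ∉ Byz)
    (hgood : GoodCommittee P Byz (l.committee l.cur))
    (hrecv : ∀ a m, (a, m) ∈ l.received → c.Sent a m)
    (hout : ∀ m ∈ out, c.Sent p m)
    (hI : ChainInvariant P Byz c l) : ChainInvariant P Byz c l' := by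
  cases h with
  | decide_superblock ha hnone hfull hdel =>
    obtain ⟨hg, hc, s, done, hs, he, hn, hr⟩ := hI
    refine ⟨hg, hc, s, done, hs, he, fun h => absurd h (by simp), fun rest hrest => ?_⟩
    obtain rfl := Option.some.inj hrest
    rw [hn hnone]
    exact ⟨p, hp, hout _ rfl⟩
  | learn_superblock sb hna hnone hr' =>
    obtain ⟨hg, hc, s, done, hs, he, hn, hr⟩ := hI
    refine ⟨hg, hc, s, done, hs, he, fun h => absurd h (by simp), fun rest hrest => ?_⟩
    obtain rfl := Option.some.inj hrest
    rw [hn hnone]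
    exact exists_correct_sent hgood (fun a => hrecv a _) hr'
  | exec_block m rest hpend =>
    obtain ⟨hg, hc, s, done, hs, he, hn, hr⟩ := hI
    refine ⟨hg, hc, s, done ++ [m], hs, ?_, fun h => absurd h (by simp), fun rest' hrest => ?_⟩
    · rw [execProposals_append, ← he]
      rfl
    · obtain rfl := Option.some.inj hrest
      simpa using hr _ hpend
  | next_instance hpend =>
    obtain ⟨hg, hc, s, done, hs, he, hn, hr⟩ := hI
    have hnew : StateBefore P Byz c (l.cur + 1) (l.vm, l.chain) := by
      rw [he]
      exact .succ _ _ _ hs (by simpa using hr _ hpend)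
    refine ⟨fun i hi => ?_, fun i hi => ?_, _, [], hnew, rfl, fun _ => rfl,
      fun rest hrest => absurd hrest (by simp)⟩
    · have hi' : i < l.cur + 1 := hi
      simp only [Function.update_of_ne (by omega : i ≠ l.cur + 1)]
      rcases Nat.lt_succ_iff_lt_or_eq.1 hi' with hi | rfl
      · exact hg i hi
      · exact hgood
    · have hi' : i ≤ l.cur + 1 := hi
      rcases Nat.le_succ_iff.1 hi' with hi | rfl
      · simp only [Function.update_of_ne (by omega : i ≠ l.cur + 1)]
        exact hc i hi
      · exact ⟨_, hnew, by simp⟩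
  | _ => exact hI.of_eq rfl rfl rfl rfl rfl

end LocalSteps

/-! ### The invariant holds in all reachable configurations -/

section Reachability

variable {Node Tx State Receipt Hash : Type*} [LinearOrder Node]
  {P : Params Node Tx State Receipt Hash} {Byz : Set Node} {c c' : Config Node Tx State Hash}

/-- `FaultBound` speaks of the current committee only, yet a node may still act in old instances.
For those the bound was stored in `good` when the node moved on. -/
theorem Invariant.instCommittee (hI : Invariant P Byz c) (hf : FaultBound P Byz c) {p : Node}
    (hp : p ∉ Byz) {i : ℕ} (hi : i ≤ (c.loc p).cur) :
    InstCommittee P Byz c i ((c.loc p).committee i) := by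
  refine ⟨?_, p, hp, hi, rfl⟩
  rcases hi.lt_or_eq with hi | rfl
  · exact (hI.chain p hp).good i hi
  · exact hf p hp

theorem Invariant.initial : Invariant P Byz (Config.initial P) := by
  refine ⟨?_, ?_, ?_, ?_, ?_, ?_⟩
  · rintro a ha m ⟨d, hd⟩
    exact absurd hd id
  · rintro a ha m ⟨d, hd⟩
    exact absurd hd id
  · rintro a ha m m' ⟨d, hd⟩
    exact absurd hd id
  · exact fun p _ a m h => absurd h id
  · exact fun p _ => ⟨fun i k m h => absurd h (by simp [Config.initial, LocalState.initial,
      InstState.initial]), fun i k m h => absurd h (by simp [Config.initial, LocalState.initial,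
      InstState.initial, BinState.initial])⟩
  · refine fun p _ => ⟨fun i hi => absurd hi (Nat.not_lt_zero i), fun i hi => ?_,
      _, [], .zero, rfl, fun _ => rfl, fun rest h => absurd h (by simp [Config.initial,
        LocalState.initial])⟩
    obtain rfl : i = 0 := Nat.le_zero.1 hi
    exact ⟨_, .zero, rfl⟩

theorem Invariant.localStep (hI : Invariant P Byz c) (hf : FaultBound P Byz c) {p : Node}
    {l' : LocalState Node Tx State Hash} {out : Set (Msg Node Tx)}
    (hp : p ∉ Byz) (h : LocalStep P p (c.loc p) l' out) :
    Invariant P Byz ⟨Function.update c.loc p l', c.net ∪ {e | e.1 = p ∧ e.2.2 ∈ out}⟩ := by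
  set c' : Config Node Tx State Hash :=
    ⟨Function.update c.loc p l', c.net ∪ {e | e.1 = p ∧ e.2.2 ∈ out}⟩ with hc'
  have hlocp : c'.loc p = l' := Function.update_self _ _ _
  have hloc : ∀ q, q ≠ p → c'.loc q = c.loc q := fun q hq => Function.update_of_ne hq _ _
  have hsent : ∀ a m, c'.Sent a m → c.Sent a m ∨ a = p ∧ m ∈ out := by
    rintro a m ⟨d, hd | hd⟩
    · exact .inl ⟨d, hd⟩
    · exact .inr hd
  have hext : Extends P Byz c c' := by
    refine Extends.of_loc Set.subset_union_left fun q _ => ?_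
    by_cases hq : q = p
    · subst hq
      rw [hlocp]
      exact ⟨h.cur_le, fun i hi => h.committee_eq hi⟩
    · rw [hloc q hq]
      exact ⟨le_rfl, fun _ _ => rfl⟩
  have hC : ∀ i ≤ (c.loc p).cur, InstCommittee P Byz c i ((c.loc p).committee i) :=
    fun i hi => hI.instCommittee hf hp hi
  have hrecv := hI.received p hp
  refine ⟨fun a ha m hm => ?_, fun a ha m hm => ?_, fun a ha m m' hm hm' he => ?_,
    fun q hq a m hm => ?_, fun q hq => ?_, fun q hq => ?_⟩
  · rcases hsent a m hm with h' | ⟨rfl, h'⟩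
    · exact (hI.justified a ha m h').mono hext
    · exact (h.justified hC hrecv hI.justified (hI.inst a ha) h').mono hext
  · by_cases hq : a = p
    · subst hq
      rw [hlocp]
      rcases hsent a m hm with hm | ⟨_, hm⟩
      · exact (hI.recorded a ha m hm).step h
      · exact h.recorded_of_mem hm
    · rw [hloc a hq]
      exact hI.recorded a ha m ((hsent a m hm).resolve_right fun h => hq h.1)
  -- `eq_of_exclusive` expects the new message first, so the case of an old `m` and a new `m'` needs
  -- symmetry.
  · have hsym : Exclusive m' m := by cases he <;> constructor
    rcases hsent a m hm with h₁ | ⟨rfl, h₁⟩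
    · rcases hsent a m' hm' with h₂ | ⟨rfl, h₂⟩
      · exact hI.unique a ha m m' h₁ h₂ he
      · exact (h.eq_of_exclusive h₂ (.inr (hI.recorded a ha m h₁)) hsym).symm
    · rcases hsent a m' hm' with h₂ | ⟨_, h₂⟩
      · exact h.eq_of_exclusive h₁ (.inr (hI.recorded a ha m' h₂)) he
      · exact h.eq_of_exclusive h₁ (.inl h₂) he
  · refine hext.sent (hI.received q hq a m ?_)
    by_cases hqp : q = p
    · subst hqp
      rwa [hlocp, h.received_eq] at hm
    · rwa [hloc q hqp] at hm
  · by_cases hqp : q = p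
    · subst hqp
      rw [hlocp]
      exact ((hI.inst q hq).step h hC hrecv hI.justified).mono hext
    · rw [hloc q hqp]
      exact (hI.inst q hq).mono hext
  · by_cases hqp : q = p
    · subst hqp
      rw [hlocp]
      -- The step is examined in the new configuration: a member that decides a superblock relies on
      -- the announcement that it is sending in this very step.
      exact ((hI.chain q hq).mono hext).step h hq (hC _ le_rfl).1
        (fun a m hm => hext.sent (hrecv a m hm)) fun m hm => ⟨q, .inr ⟨rfl, hm⟩⟩
    · rw [hloc q hqp]
      exact (hI.chain q hq).mono hext

theorem Invariant.receive (hI : Invariant P Byz c) {a p : Node} {m : Msg Node Tx}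
    (h : (a, p, m) ∈ c.net) :
    Invariant P Byz ⟨Function.update c.loc p
      { c.loc p with received := insert (a, m) (c.loc p).received }, c.net⟩ := by
  set c' : Config Node Tx State Hash := ⟨Function.update c.loc p
    { c.loc p with received := insert (a, m) (c.loc p).received }, c.net⟩ with hc'
  -- A uniform description of all nodes, the receiver included: only `received` may change, and only
  -- by messages that were sent.
  have hloc : ∀ q, ∃ R ⊆ {e : Node × Msg Node Tx | c.Sent e.1 e.2} ∪ (c.loc q).received,
      c'.loc q = { c.loc q with received := R } := by
    intro q
    by_cases hq : q = p
    · subst hq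
      refine ⟨_, ?_, Function.update_self _ _ _⟩
      exact Set.insert_subset (.inl ⟨q, h⟩) Set.subset_union_right
    · exact ⟨_, Set.subset_union_right, Function.update_of_ne hq _ _⟩
  have hext : Extends P Byz c c' := by
    refine Extends.of_loc subset_rfl fun q _ => ?_
    obtain ⟨R, _, hR⟩ := hloc q
    rw [hR]
    exact ⟨le_rfl, fun _ _ => rfl⟩
  refine ⟨fun a ha m hm => (hI.justified a ha m hm).mono hext, fun a ha m hm => ?_,
    hI.unique, fun q hq a m hm => ?_, fun q hq => ?_, fun q hq => ?_⟩
  · obtain ⟨R, _, hR⟩ := hloc a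
    rw [hR]
    have := hI.recorded a ha m hm
    cases m <;> exact this
  · obtain ⟨R, hsub, hR⟩ := hloc q
    rw [hR] at hm
    exact (hsub hm).elim id (hI.received q hq a m)
  · obtain ⟨R, _, hR⟩ := hloc q
    rw [hR]
    have := (hI.inst q hq).mono hext
    exact ⟨this.props, this.decision⟩
  · obtain ⟨R, _, hR⟩ := hloc q
    rw [hR]
    exact ((hI.chain q hq).mono hext).of_eq rfl rfl rfl rfl rfl

theorem Invariant.byzantine (hI : Invariant P Byz c) {a p : Node} {m : Msg Node Tx}
    (ha : a ∈ Byz) : Invariant P Byz ⟨c.loc, insert (a, p, m) c.net⟩ := by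
  have hext : Extends P Byz c ⟨c.loc, insert (a, p, m) c.net⟩ :=
    Extends.of_loc (Set.subset_insert _ _) fun q _ => ⟨le_rfl, fun _ _ => rfl⟩
  have hsent : ∀ q ∉ Byz, ∀ m', (⟨c.loc, insert (a, p, m) c.net⟩ : Config _ _ _ _).Sent q m' →
      c.Sent q m' := by
    rintro q hq m' ⟨d, hd | hd⟩
    · exact absurd ha ((Prod.mk.inj hd).1 ▸ hq)
    · exact ⟨d, hd⟩
  exact ⟨fun q hq m' hm => (hI.justified q hq m' (hsent q hq m' hm)).mono hext,
    fun q hq m' hm => hI.recorded q hq m' (hsent q hq m' hm),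
    fun q hq m₁ m₂ h₁ h₂ => hI.unique q hq m₁ m₂ (hsent q hq _ h₁) (hsent q hq _ h₂),
    fun q hq b m' hm => hext.sent (hI.received q hq b m' hm),
    fun q hq => (hI.inst q hq).mono hext, fun q hq => (hI.chain q hq).mono hext⟩

theorem Reachable.invariant (h : Reachable P Byz c) : Invariant P Byz c := by
  induction h with
  | initial => exact .initial
  | step c c' _ hf h ih =>
    cases h with
    | loc p l' out hp h => exact ih.localStep hf hp h
    | receive a p m hp h => exact ih.receive h
    | byzantine a p m ha => exact ih.byzantine ha

end Reachability

/-! ### Agreement within one configuration, and comparison of chains -/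

section Agreement

variable {Node Tx State Receipt Hash : Type*} [LinearOrder Node]
  {P : Params Node Tx State Receipt Hash} {Byz : Set Node} {c : Config Node Tx State Hash}

/-- Correct nodes that have started instance `i` agree on its committee. -/
def CommitteeAgreement (P : Params Node Tx State Receipt Hash) (Byz : Set Node)
    (c : Config Node Tx State Hash) (i : ℕ) : Prop :=
  ∀ C C', InstCommittee P Byz c i C → InstCommittee P Byz c i C' → C = C'

/-- Two sets of more than (n + t)/2 members meet in more than t members, and a correct common member
echoed only one proposal of `k`. -/
theorem EchoQuorum.agreement (hI : Invariant P Byz c) {i : ℕ} (hC : CommitteeAgreement P Byz c i)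
    {k : Node} {m m' : Proposal Tx} (h : EchoQuorum P Byz c i k m)
    (h' : EchoQuorum P Byz c i k m') : m = m' := by
  obtain ⟨C, hc, hq⟩ := h
  obtain ⟨C', hc', hq'⟩ := h'
  obtain rfl := hC C C' hc hc'
  have := count_add_count_le C (fun a => c.Sent a (.echo i k m)) (fun a => c.Sent a (.echo i k m'))
  have hg := hc.1.1
  obtain ⟨a, _, ⟨h₁, h₂⟩, ha⟩ := exists_of_count_lt (C := C) (p := (· ∈ Byz))
    (q := fun a => c.Sent a (.echo i k m) ∧ c.Sent a (.echo i k m')) (by omega)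
  have := hI.unique a ha _ _ h₁ h₂ (.echo i k m m')
  injection this

theorem newEst_of_mem {r : ℕ} {vals : Finset Bool} (h : decide (r % 2 = 1) ∈ vals) :
    newEst r vals = decide (r % 2 = 1) := by
  unfold newEst
  split_ifs with h₁ h₂
  · rw [h₁, Finset.mem_singleton] at h
    exact h.symm
  · rw [h₂, Finset.mem_singleton] at h
    exact h.symm
  · rfl

theorem newEst_singleton (r : ℕ) (v : Bool) : newEst r {v} = v := by
  cases v <;> simp [newEst]

/-- Any end of a round in which `v` may be decided involves `v`. -/
theorem RoundEnd.mem_of_singleton (hI : Invariant P Byz c) {i : ℕ}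
    (hC : CommitteeAgreement P Byz c i) {k : Node} {r : ℕ} {v : Bool} {vals : Finset Bool}
    (h : RoundEnd P Byz c i k r {v}) (h' : RoundEnd P Byz c i k r vals) : v ∈ vals := by
  obtain ⟨_, _, _, C, hc, hq⟩ := h
  obtain ⟨_, _, _, C', hc', hq'⟩ := h'
  obtain rfl := hC C C' hc hc'
  have := count_add_count_le C (fun a => ∃ s ⊆ {v}, c.Sent a (.aux i k r s))
    (fun a => ∃ s ⊆ vals, c.Sent a (.aux i k r s))
  have hg := hc.1.1
  have hg' := hc.1.2
  obtain ⟨a, _, ⟨⟨s, hs, h₁⟩, ⟨s', hs', h₂⟩⟩, ha⟩ := exists_of_count_lt (C := C) (p := (· ∈ Byz))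
    (q := fun a => (∃ s ⊆ {v}, c.Sent a (.aux i k r s)) ∧ ∃ s ⊆ vals, c.Sent a (.aux i k r s))
    (by omega)
  have heq := hI.unique a ha _ _ h₁ h₂ (.aux i k r s s')
  injection heq with _ _ _ heq
  subst heq
  -- An empty content would be compatible with every `vals`; being non-empty forces `s = {v}`.
  have hne : s.Nonempty := hI.justified a ha _ h₁
  rcases Finset.subset_singleton_iff.1 hs with rfl | rfl
  · exact absurd hne Finset.not_nonempty_empty
  · exact hs' (Finset.mem_singleton_self v)

/-- Once `v` may be decided in round `r`, all correct nodes support `v` in all later rounds. -/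
theorem RoundEnd.bval_eq (hI : Invariant P Byz c) {i : ℕ} (hC : CommitteeAgreement P Byz c i)
    {k : Node} {r : ℕ} {v : Bool} (hv : v = decide (r % 2 = 1))
    (h : RoundEnd P Byz c i k r {v}) {r' : ℕ} (hr : r < r') {a : Node} (ha : a ∉ Byz) {w : Bool}
    (hw : c.Sent a (.bval i k r' w)) : w = v := by
  induction r', hr using Nat.le_induction generalizing a w with
  | base =>
    -- The BVAL value is the estimate after an end of round `r`. As `v` is in `vals` and is the
    -- parity of `r`, even two values yield `v`.
    obtain ⟨vals, hvals, rfl⟩ := hI.justified a ha _ hw (Nat.succ_le_succ h.1)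
    have := h.mem_of_singleton hI hC hvals
    subst hv
    exact newEst_of_mem this
  | succ r' hr ih =>
    obtain ⟨vals, hvals, rfl⟩ := hI.justified a ha _ hw (by omega)
    -- Parity no longer matters: each value of round `r'` was supported by a correct member, hence
    -- equals `v`.
    have hsub : vals = {v} := by
      refine Finset.eq_singleton_iff_nonempty_unique_mem.2 ⟨hvals.2.1, fun w hw => ?_⟩
      obtain ⟨b, hb, hs⟩ := hvals.2.2.1 w hw
      exact ih hb hs
    rw [hsub, newEst_singleton]

theorem BinDecided.agreement (hI : Invariant P Byz c) {i : ℕ}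
    (hC : CommitteeAgreement P Byz c i) {k : Node} {v v' : Bool}
    (h : BinDecided P Byz c i k v) (h' : BinDecided P Byz c i k v') : v = v' := by
  obtain ⟨r, hv, hr⟩ := h
  obtain ⟨r', hv', hr'⟩ := h'
  rcases lt_trichotomy r r' with hlt | rfl | hlt
  · obtain ⟨a, ha, hs⟩ := hr'.2.2.1 v' (Finset.mem_singleton_self v')
    exact (hr.bval_eq hI hC hv hlt ha hs).symm
  · rw [hv, hv']
  · obtain ⟨a, ha, hs⟩ := hr.2.2.1 v (Finset.mem_singleton_self v)
    exact hr'.bval_eq hI hC hv' hlt ha hs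

/-- With the same members in the same order, the lists agree entry by entry. Deliveries need to
agree only where the common bit is 1, as the others are filtered out. -/
theorem SuperblockDecided.agreement (hI : Invariant P Byz c) {i : ℕ}
    (hC : CommitteeAgreement P Byz c i) {sb sb' : Superblock Tx}
    (h : SuperblockDecided P Byz c i sb) (h' : SuperblockDecided P Byz c i sb') : sb = sb' := by
  obtain ⟨C, D, props, hc, hD, hp, rfl⟩ := h
  obtain ⟨C', D', props', hc', hD', hp', rfl⟩ := h'
  obtain rfl := hC C C' hc hc'
  refine List.filterMap_congr fun k hk => ?_
  have hk : k ∈ C := (Finset.mem_sort _).1 hk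
  obtain ⟨v, hv, hb⟩ := hD k hk
  obtain ⟨v', hv', hb'⟩ := hD' k hk
  obtain rfl := hb.agreement hI hC hb'
  rw [hv, hv']
  split_ifs with h1
  · obtain ⟨m, hm, he⟩ := hp k hk (hv.trans h1)
    obtain ⟨m', hm', he'⟩ := hp' k hk (hv'.trans h1)
    rw [hm, hm', he.agreement hI hC he']
  · rfl

theorem Announced.agreement_of_committee (hI : Invariant P Byz c) {i : ℕ}
    (hC : CommitteeAgreement P Byz c i) {sb sb' : Superblock Tx}
    (h : Announced Byz c i sb) (h' : Announced Byz c i sb') : sb = sb' := by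
  obtain ⟨a, ha, hs⟩ := h
  obtain ⟨a', ha', hs'⟩ := h'
  exact SuperblockDecided.agreement hI hC (hI.justified a ha _ hs) (hI.justified a' ha' _ hs')

/-- The induction that ties execution to consensus: deterministic execution turns agreement on
earlier superblocks into agreement on the next committee. -/
theorem StateBefore.unique (hI : Invariant P Byz c) {i : ℕ} {s s' : State × List (Block Tx Hash)}
    (h : StateBefore P Byz c i s) (h' : StateBefore P Byz c i s') : s = s' := by
  induction i generalizing s s' with
  | zero =>
    cases h
    cases h'
    rfl
  | succ i ih =>
    obtain _ | ⟨_, s, sb, hs, hsb⟩ := h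
    obtain _ | ⟨_, s', sb', hs', hsb'⟩ := h'
    obtain rfl := ih hs hs'
    -- Each committee is read from some state before instance `i`, and the induction hypothesis
    -- makes that state unique.
    have hC : CommitteeAgreement P Byz c i := by
      rintro _ _ ⟨_, q, hq, hi, rfl⟩ ⟨_, q', hq', hi', rfl⟩
      obtain ⟨s₁, hs₁, h₁⟩ := (hI.chain q hq).committee i hi
      obtain ⟨s₂, hs₂, h₂⟩ := (hI.chain q' hq').committee i hi'
      rw [h₁, h₂, ih hs₁ hs₂]
    rw [hsb.agreement_of_committee hI hC hsb']

theorem Announced.agreement (hI : Invariant P Byz c) {i : ℕ} {sb sb' : Superblock Tx}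
    (h : Announced Byz c i sb) (h' : Announced Byz c i sb') : sb = sb' := by
  refine h.agreement_of_committee hI ?_ h'
  rintro _ _ ⟨_, q, hq, hi, rfl⟩ ⟨_, q', hq', hi', rfl⟩
  obtain ⟨s₁, hs₁, h₁⟩ := (hI.chain q hq).committee i hi
  obtain ⟨s₂, hs₂, h₂⟩ := (hI.chain q' hq').committee i hi'
  rw [h₁, h₂, hs₁.unique hI hs₂]

/-- The chain of a node that runs instance `i` is a prefix of the chain at the end of `i`. -/
theorem Invariant.chain_prefix (hI : Invariant P Byz c) {p : Node} (hp : p ∉ Byz)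
    {s : State × List (Block Tx Hash)} (hs : StateBefore P Byz c (c.loc p).cur s)
    {sb : Superblock Tx} (hsb : Announced Byz c (c.loc p).cur sb) :
    (c.loc p).chain <+: (execProposals P s sb).2 := by
  obtain ⟨s', done, hs', he, hn, hr⟩ := (hI.chain p hp).exec
  obtain rfl := hs.unique hI hs'
  rw [show (c.loc p).chain = (execProposals P s done).2 from congrArg Prod.snd he]
  cases hpend : (c.loc p).pending with
  | none =>
    rw [hn hpend]
    exact prefix_execProposals P s sb
  | some rest =>
    rw [hsb.agreement hI (hr rest hpend), execProposals_append]
    exact prefix_execProposals P _ _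

theorem Invariant.prefix_of_cur_lt (hI : Invariant P Byz c) {p q : Node} (hp : p ∉ Byz)
    (hq : q ∉ Byz) (h : (c.loc p).cur < (c.loc q).cur) : (c.loc p).chain <+: (c.loc q).chain := by
  obtain ⟨s, done, hs, he, _⟩ := (hI.chain q hq).exec
  obtain ⟨s', sb, hs', hsb, hpre⟩ := hs.exists_prefix h
  refine (hI.chain_prefix hp hs' hsb).trans (hpre.trans ?_)
  rw [show (c.loc q).chain = (execProposals P s done).2 from congrArg Prod.snd he]
  exact prefix_execProposals P s done

theorem Invariant.prefix_of_pending_none (hI : Invariant P Byz c) {p q : Node} (hp : p ∉ Byz)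
    (hq : q ∉ Byz) (h : (c.loc p).cur = (c.loc q).cur) (hn : (c.loc p).pending = none) :
    (c.loc p).chain <+: (c.loc q).chain := by
  obtain ⟨s, done, hs, he, hdone, _⟩ := (hI.chain p hp).exec
  obtain ⟨s', done', hs', he', _⟩ := (hI.chain q hq).exec
  rw [h] at hs
  obtain rfl := hs.unique hI hs'
  rw [show (c.loc p).chain = (execProposals P s done).2 from congrArg Prod.snd he,
    show (c.loc q).chain = (execProposals P s done').2 from congrArg Prod.snd he', hdone hn]
  exact prefix_execProposals P s done'

theorem Invariant.prefix_or_prefix (hI : Invariant P Byz c) {p q : Node} (hp : p ∉ Byz)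
    (hq : q ∉ Byz) :
    (c.loc p).chain <+: (c.loc q).chain ∨ (c.loc q).chain <+: (c.loc p).chain := by
  rcases lt_trichotomy (c.loc p).cur (c.loc q).cur with h | h | h
  · exact .inl (hI.prefix_of_cur_lt hp hq h)
  · cases hpend : (c.loc p).pending with
    | none => exact .inl (hI.prefix_of_pending_none hp hq h hpend)
    | some rest =>
      obtain ⟨s, done, hs, _, _, hr⟩ := (hI.chain p hp).exec
      -- One announcement bounds both chains, even if `q` is still waiting for its superblock.
      have hsb := hr rest hpend
      have hpre := hI.chain_prefix hp hs hsb
      rw [h] at hs hsb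
      exact List.prefix_or_prefix_of_prefix hpre (hI.chain_prefix hq hs hsb)
  · exact .inr (hI.prefix_of_cur_lt hq hp h)

end Agreement

end SocChain

theorem mainTheorem3 {Node Tx State Receipt Hash : Type*} [LinearOrder Node]
    (P : SocChain.Params Node Tx State Receipt Hash) (Byz : Set Node)
    (c : SocChain.Config Node Tx State Hash) (hc : SocChain.Reachable P Byz c)
    (p q : Node) (hp : p ∉ Byz) (hq : q ∉ Byz) :
    (c.loc p).chain = (c.loc q).chain ∨
      (c.loc p).chain <+: (c.loc q).chain ∨
      (c.loc q).chain <+: (c.loc p).chain :=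
  .inr (hc.invariant.prefix_or_prefix hp hq)
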